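/- Theorem (distillation under local operations). Let $A,B$ be finite-dimensional Hilbert spaces, let $|\psi\rangle\in A\otimes B$ be a unit vector with Schmidt decomposition $|\psi\rangle=\sum_{x}\sqrt{P(x)}\,|u_x\rangle|v_x\rangle$ (orthonormal families $(u_x)$, $(v_x)$, $P\ge 0$, so that $P$ is a probability distribution), and let $r=\operatorname{rank}(P)$ be the number of $x$ with $P(x)\neq 0$. Let $d\ge 1$, $m,n\ge 0$ be integers, and let $|\Phi^+_d\rangle=d^{-1/2}\sum_{i=1}^d|i\rangle|i\rangle$. For density matrices $\rho$ on $A'\otimes B'$ and $\sigma$ on $A\otimes B$ let $$F_{LO}(\rho,\sigma)=\max_{\mathcal E,\mathcal F}F\big(\rho,(\mathcal E\otimes\mathcal F)(\sigma)\big),\qquad F(R,S)=\Big(\operatorname{Tr}\sqrt{\sqrt S\,R\,\sqrt S}\Big)^2,$$ where $\mathcal E$ and $\mathcal F$ range over the quantum channels (completely positive trace-preserving linear maps) from operators on $A$ to operators on $A'$ and from operators on $B$ to operators on $B'$, respectively. Let $p_n^{\downarrow}(1)\ge p_n^{\downarrow}(2)\ge\cdots$ be the entries of the product distribution $P^{\otimes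 n}$ in decreasing order, let $\mathcal I=\{1,\dots,\lceil r^n/d^m\rceil\}$, and for $i\in\mathcal I$ let $$\alpha_i=\sum_{j=(i-1)d^m+1}^{\min\{i\,d^m,\;r^n\}}\sqrt{p_n^{\downarrow}(j)} .$$ Let $K\ge|\mathcal I|$ be an integer (for instance $K=r^n d^m$), and let $\mathcal P^{\downarrow}(K)$ be the set of probability distributions $p'$ on $\{1,\dots,K\}$ with $p'(1)\ge\cdots\ge p'(K)$. For the seed $|\psi\rangle^{\otimes n}$ and the target $|\Phi_d^+\rangle^{\otimes m}$, shared between the same two parties (one party holds all the left tensor factors, the other all the right ones), the maximum defining $F_{LO}$ and the minimum below are attained, and $$F_{LO}\big(|\Phi_d^+\rangle^{\otimes m},|\psi\rangle^{\otimes n}\big)=d^{-m}\Big[\min_{p'\in\mathcal P^{\downarrow}(K)}\;-\sum_{i\in\mathcal I}\alpha_i\sqrt{p'(i)}\Big]^2 .$$ Moreover the minimization is a convex program: $\mathcal P^{\downarrow}(K)$ is convex and $p'\mapsto-\sum_{i\in\mathcal I}\alpha_i\sqrt{p'(i)}$ is a convex function on it. -/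

import Mathlib

open scoped Kronecker MatrixOrder ComplexOrder

noncomputable section

namespace LocalConversion

/-! ### Pure states of a bipartite system -/

/-- Vectors of the bipartite space `ℂ^α ⊗ ℂ^β`, written in the computational product basis. -/
abbrev Bipartite (α β : Type*) := EuclideanSpace ℂ (α × β)

/-- The density matrix `|ψ⟩⟨ψ|`. -/
def density {α β : Type*} (ψ : Bipartite α β) : Matrix (α × β) (α × β) ℂ :=
  Matrix.of fun x y => ψ x * star (ψ y)

/-- `ψ^{⊗n}` as a bipartite vector of `(ℂ^α)^{⊗n} ⊗ (ℂ^β)^{⊗n}`: one party holds all the left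
factors, the other party all the right ones. -/
def tensorPower {α β : Type*} (ψ : Bipartite α β) (n : ℕ) : Bipartite (Fin n → α) (Fin n → β) :=
  WithLp.toLp 2 fun x => ∏ t, ψ (x.1 t, x.2 t)

/-- The maximally entangled state `d^{-1/2} ∑ i, |i⟩|i⟩` of local dimension `d`. -/
def maxEntangled (d : ℕ) : Bipartite (Fin d) (Fin d) :=
  WithLp.toLp 2 fun x => if x.1 = x.2 then (((√(d : ℝ))⁻¹ : ℝ) : ℂ) else 0

/-- `ψ = ∑ i, √(p i) u i ⊗ v i` with `p ≥ 0` and orthonormal families `u`, `v`. Zero weights are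
allowed. If `ψ` is a unit vector, then `p` is a probability distribution. -/
structure IsSchmidtDecomposition {α β κ : Type*} [Fintype α] [Fintype β] [Fintype κ]
    (ψ : Bipartite α β) (p : κ → ℝ)
    (u : κ → EuclideanSpace ℂ α) (v : κ → EuclideanSpace ℂ β) : Prop where
  nonneg : ∀ i, 0 ≤ p i
  orthonormal_left : Orthonormal ℂ u
  orthonormal_right : Orthonormal ℂ v
  eq_sum : ∀ a b, ψ (a, b) = ∑ i, ((√(p i) : ℝ) : ℂ) * (u i a * v i b)

/-- Every bipartite vector has a Schmidt decomposition. -/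
theorem exists_isSchmidtDecomposition {α β : Type*} [Fintype α] [Fintype β] (ψ : Bipartite α β) :
    ∃ (s : Finset α) (p : s → ℝ) (u : s → EuclideanSpace ℂ α) (v : s → EuclideanSpace ℂ β),
      IsSchmidtDecomposition ψ p u v := by
  classical
  let M : Matrix α β ℂ := Matrix.of fun a b => ψ (a, b)
  have hM : (M * M.conjTranspose).PosSemidef := Matrix.posSemidef_self_mul_conjTranspose M
  let e := hM.isHermitian.eigenvectorBasis
  let l := hM.isHermitian.eigenvalues
  have hl : ∀ i, 0 ≤ l i := hM.eigenvalues_nonneg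
  -- the vectors `M† e i`
  let w : α → β → ℂ := fun i => M.conjTranspose.mulVec (e i)
  have hw : ∀ i j, star (w i) ⬝ᵥ w j = if i = j then (l i : ℂ) else 0 := by
    intro i j
    have h1 : star (w i) ⬝ᵥ w j = star (e i).ofLp ⬝ᵥ ((M * M.conjTranspose).mulVec (e j)) := by
      simp only [w, Matrix.star_mulVec, Matrix.conjTranspose_conjTranspose]
      rw [← Matrix.dotProduct_mulVec, Matrix.mulVec_mulVec]
    have h2 : (M * M.conjTranspose).mulVec (e j) = (l j : ℂ) • (e j).ofLp := by
      have := hM.isHermitian.mulVec_eigenvectorBasis j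
      rw [this]; ext a; simp [l, e]
    have h3 : star (e i).ofLp ⬝ᵥ (e j).ofLp = if i = j then 1 else 0 := by
      have := (orthonormal_iff_ite.1 e.orthonormal) i j
      rw [← this, EuclideanSpace.inner_eq_star_dotProduct, dotProduct_comm]
    rw [h1, h2, dotProduct_smul, h3]
    split_ifs with h
    · subst h; simp
    · simp
  have hsq : ∀ i, l i ≠ 0 → ((√(l i) : ℝ) : ℂ) ≠ 0 := fun i hi => by
    have := Real.sqrt_ne_zero'.2 (lt_of_le_of_ne (hl i) (Ne.symm hi))
    exact_mod_cast this
  have hw0 : ∀ i, l i = 0 → w i = 0 := by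
    intro i hi
    have := hw i i
    simp only [if_true, hi, Complex.ofReal_zero] at this
    exact dotProduct_star_self_eq_zero.1 this
  have hsum : ∀ a b, ψ (a, b) = ∑ i, (e i) a * star (w i b) := by
    intro a b
    have h := e.sum_repr' (WithLp.toLp 2 fun a => M a b)
    have h' := congrArg (fun x : EuclideanSpace ℂ α => x a) h
    simp only [WithLp.ofLp_sum, WithLp.ofLp_smul, Finset.sum_apply, Pi.smul_apply,
      smul_eq_mul] at h'
    change M a b = _
    rw [← h']
    refine Finset.sum_congr rfl fun i _ => ?_
    rw [mul_comm]
    congr 1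
    simp only [w, Matrix.mulVec, dotProduct, Matrix.conjTranspose_apply, star_sum, star_mul',
      star_star, EuclideanSpace.inner_eq_star_dotProduct, Pi.star_apply]
  refine ⟨Finset.univ.filter fun i => l i ≠ 0, fun i => l i, fun i => e i,
    fun i => WithLp.toLp 2 fun b => star (w i b) / ((√(l i) : ℝ) : ℂ),
    fun i => hl i, e.orthonormal.comp _ Subtype.val_injective, ?_, ?_⟩
  · rw [orthonormal_iff_ite]
    rintro ⟨i, hi⟩ ⟨j, hj⟩
    have hi' := (Finset.mem_filter.1 hi).2
    have hj' := (Finset.mem_filter.1 hj).2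
    have h := hw j i
    simp only [dotProduct, Pi.star_apply] at h
    have hh : inner ℂ (WithLp.toLp 2 fun b => star (w i b) / ((√(l i) : ℝ) : ℂ) :
          EuclideanSpace ℂ β) (WithLp.toLp 2 fun b => star (w j b) / ((√(l j) : ℝ) : ℂ)) =
        (∑ b, star (w j b) * w i b) / (((√(l i) : ℝ) : ℂ) * ((√(l j) : ℝ) : ℂ)) := by
      rw [EuclideanSpace.inner_eq_star_dotProduct, dotProduct, Finset.sum_div]
      refine Finset.sum_congr rfl fun b _ => ?_
      simp only [Pi.star_apply, star_div₀, Complex.star_def, Complex.conj_ofReal,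
        Complex.conj_conj]
      have := hsq i hi'
      have := hsq j hj'
      field_simp
    rw [hh, h]
    by_cases hij : i = j
    · subst hij
      simp only [if_true]
      rw [← Complex.ofReal_mul, Real.mul_self_sqrt (hl i)]
      exact div_self (by exact_mod_cast hi')
    · simp [hij, Ne.symm hij]
  · intro a b
    rw [hsum a b, Finset.sum_coe_sort (Finset.univ.filter fun i => l i ≠ 0)
      (fun i => ((√(l i) : ℝ) : ℂ) * ((e i) a * (star (w i b) / ((√(l i) : ℝ) : ℂ)))),
      Finset.sum_filter]
    refine Finset.sum_congr rfl fun i _ => ?_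
    split_ifs with h
    · have := hsq i h
      field_simp
    · rw [hw0 i (not_not.1 h)]; simp

/-! ### Quantum channels -/

/-- The map `id_k ⊗ E` on `k × k` block matrices. -/
def ampliation {α β : Type*} (k : ℕ) (E : Matrix α α ℂ →ₗ[ℂ] Matrix β β ℂ)
    (X : Matrix (Fin k × α) (Fin k × α) ℂ) : Matrix (Fin k × β) (Fin k × β) ℂ :=
  Matrix.of fun x y => E (Matrix.of fun a a' => X (x.1, a) (y.1, a')) x.2 y.2

/-- Quantum channels: completely positive and trace preserving linear maps. -/
structure IsChannel {α β : Type*} [Fintype α] [Fintype β]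
    (E : Matrix α α ℂ →ₗ[ℂ] Matrix β β ℂ) : Prop where
  completelyPositive : ∀ (k : ℕ) (X : Matrix (Fin k × α) (Fin k × α) ℂ),
    X.PosSemidef → (ampliation k E X).PosSemidef
  tracePreserving : ∀ X, (E X).trace = X.trace

/-- The tensor product `E ⊗ F` of linear maps on matrices, given on matrix units by
`|a⟩⟨a'| ⊗ |b⟩⟨b'| ↦ E(|a⟩⟨a'|) ⊗ F(|b⟩⟨b'|)`. -/
def tensorMap {α β α' β' : Type*} [Fintype α] [Fintype β] [DecidableEq α] [DecidableEq β]
    (E : Matrix α α ℂ →ₗ[ℂ] Matrix α' α' ℂ) (F : Matrix β β ℂ →ₗ[ℂ] Matrix β' β' ℂ)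
    (ρ : Matrix (α × β) (α × β) ℂ) : Matrix (α' × β') (α' × β') ℂ :=
  ∑ a, ∑ a', ∑ b, ∑ b', ρ (a, b) (a', b') •
    (E (Matrix.single a a' 1) ⊗ₖ F (Matrix.single b b' 1))

/-- `E ⊗ F` acts on product matrices as it should. -/
theorem tensorMap_kronecker {α β α' β' : Type*} [Fintype α] [Fintype β]
    [DecidableEq α] [DecidableEq β]
    (E : Matrix α α ℂ →ₗ[ℂ] Matrix α' α' ℂ) (F : Matrix β β ℂ →ₗ[ℂ] Matrix β' β' ℂ)
    (X : Matrix α α ℂ) (Y : Matrix β β ℂ) :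
    tensorMap E F (X ⊗ₖ Y) = E X ⊗ₖ F Y := by
  have hX : E X = ∑ a, ∑ a', X a a' • E (Matrix.single a a' 1) := by
    conv_lhs => rw [Matrix.matrix_eq_sum_single X]
    simp only [map_sum]
    refine Finset.sum_congr rfl fun a _ => Finset.sum_congr rfl fun a' _ => ?_
    rw [← map_smul, Matrix.smul_single, smul_eq_mul, mul_one]
  have hY : F Y = ∑ a, ∑ a', Y a a' • F (Matrix.single a a' 1) := by
    conv_lhs => rw [Matrix.matrix_eq_sum_single Y]
    simp only [map_sum]
    refine Finset.sum_congr rfl fun a _ => Finset.sum_congr rfl fun a' _ => ?_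
    rw [← map_smul, Matrix.smul_single, smul_eq_mul, mul_one]
  ext ⟨i, j⟩ ⟨k, l⟩
  rw [hX, hY]
  simp only [tensorMap, Matrix.kroneckerMap_apply, Matrix.sum_apply, Matrix.smul_apply, smul_eq_mul]
  simp_rw [Finset.sum_mul, Finset.mul_sum]
  refine Finset.sum_congr rfl (fun a _ => Finset.sum_congr rfl (fun a' _ =>
    Finset.sum_congr rfl (fun b _ => Finset.sum_congr rfl (fun b' _ => by ring))))

/-! ### Fidelity and conversion under local operations -/

/-- The fidelity `F(R, S) = (Tr √(√S R √S))²` of positive semidefinite matrices. -/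
def fidelity {ι : Type*} [Fintype ι] [DecidableEq ι] (R S : Matrix ι ι ℂ) : ℝ :=
  (Matrix.trace (CFC.sqrt (CFC.sqrt S * R * CFC.sqrt S))).re ^ 2

/-- The fidelities with the target `ρ` that local operations `E ⊗ F` reach from the seed `σ`. -/
def loFidelities {α β α' β' : Type*} [Fintype α] [Fintype β] [Fintype α'] [Fintype β']
    [DecidableEq α] [DecidableEq β] [DecidableEq α'] [DecidableEq β']
    (ρ : Matrix (α' × β') (α' × β') ℂ) (σ : Matrix (α × β) (α × β) ℂ) : Set ℝ :=
  {x | ∃ (E : Matrix α α ℂ →ₗ[ℂ] Matrix α' α' ℂ) (F : Matrix β β ℂ →ₗ[ℂ] Matrix β' β' ℂ),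
    IsChannel E ∧ IsChannel F ∧ x = fidelity ρ (tensorMap E F σ)}

/-- The optimal fidelity `F_LO(ρ, σ)` of converting the seed `σ` to the target `ρ` under local
operations. -/
def optimalFidelityLO {α β α' β' : Type*} [Fintype α] [Fintype β] [Fintype α'] [Fintype β']
    [DecidableEq α] [DecidableEq β] [DecidableEq α'] [DecidableEq β']
    (ρ : Matrix (α' × β') (α' × β') ℂ) (σ : Matrix (α × β) (α × β) ℂ) : ℝ :=
  sSup (loFidelities ρ σ)

/-! ### Distributions -/

/-- The product distribution `P^{⊗n}`. -/
def productDist {κ : Type*} (p : κ → ℝ) (n : ℕ) : (Fin n → κ) → ℝ :=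
  fun x => ∏ t, p (x t)

/-- The values of `q`, with multiplicity, in decreasing order and continued by zeros; the position
`j` counts from `0`. -/
def sortedDesc {ι : Type*} [Fintype ι] (q : ι → ℝ) (j : ℕ) : ℝ :=
  ((Finset.univ.val.map q).sort (· ≥ ·)).getD j 0

/-- The number of non-zero weights. -/
def distRank {κ : Type*} (p : κ → ℝ) : ℕ := Nat.card {i // p i ≠ 0}

/-- The decreasing probability distributions on an alphabet with `K` letters. -/
def decreasingDist (K : ℕ) : Set (Fin K → ℝ) :=
  {q | (∀ i, 0 ≤ q i) ∧ ∑ i, q i = 1 ∧ Antitone q}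

/-! ### The distillation program -/

/-- The number `⌈rank(P)^n / d^m⌉` of blocks. -/
def numBlocks {κ : Type*} (p : κ → ℝ) (d m n : ℕ) : ℕ :=
  ⌈((distRank p : ℝ) ^ n) / ((d : ℝ) ^ m)⌉₊

/-- The sum of `√` of the entries of the sorted `P^{⊗n}` over the block number `i` (counted from
`0`) of length `d^m`, where the last block ends at `rank(P)^n`. -/
def blockCoeff {κ : Type*} [Fintype κ] (p : κ → ℝ) (d m n i : ℕ) : ℝ :=
  ∑ j ∈ Finset.Ico (i * d ^ m) (min ((i + 1) * d ^ m) (distRank p ^ n)),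
    √(sortedDesc (productDist p n) j)

/-- The objective `-∑ α_i √(q i)`, summed over the blocks. -/
def distillationObjective {κ : Type*} [Fintype κ] (p : κ → ℝ) (d m n K : ℕ)
    (q : Fin K → ℝ) : ℝ :=
  -∑ i ∈ Finset.univ.filter (fun i : Fin K => (i : ℕ) < numBlocks p d m n),
    blockCoeff p d m n i * √(q i)

end LocalConversion

end

/-! Write D = d^m, q = P^{⊗n}, and b_i (`blockSum`) for the sum of √q over the i-th block of D
entries in decreasing order. Both sides equal D⁻¹ ∑ b_i².

For the program, b is decreasing, so the Cauchy-Schwarz optimum p' ∝ b² is already admissible and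
the minimum is -√(∑ b_i²) (`isLeast_neg_sum_mul_sqrt`).

For the channels, fidelity with a pure state is an expectation value, so Kraus operators K_k, L_l
reach D⁻¹ ∑ |T_kl|², where T_kl is the overlap of (K_k ⊗ L_l)ψ^{⊗n} with ∑ |c⟩|c⟩. To attain the
value, both parties project onto the i-th block of Schmidt vectors and send it to the standard
basis; the matching outcomes contribute b_i² (`diagOverlap_blockReadout`).

For the upper bound, a singular value decomposition of T replaces the Kraus operators by mixtures
A_s, B_s that remain jointly contractive and whose overlaps are the singular values β_s. By AM-GM,
β_s ≤ ∑_j N_sj √q_j with N_sj = (‖A_s u_j‖² + ‖B_s v_j‖²)/2, where u_j, v_j are the Schmidt vectors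
of ψ^{⊗n}. Row sums of N are at most D, because A_s and B_s are contractions into dimension D;
column sums are at most 1, by joint contractivity. Hence the l largest β_s sum to at most b_0 + … +
b_{l-1}, and this weak majorization yields ∑ β_s² ≤ ∑ b_i² (`sum_sq_le_sum_blockSum_sq`). -/

namespace LocalConversion

/-! ### Decreasing rearrangements -/

section Sorting

variable {ι : Type*} [Fintype ι]

/-- The decreasing rearrangement is a reindexing. -/
theorem exists_equiv_sortedDesc (q : ι → ℝ) :
    ∃ e : Fin (Fintype.card ι) ≃ ι, ∀ j : Fin (Fintype.card ι), sortedDesc q (j : ℕ) = q (e j) := by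
  let f := q ∘ (Fintype.equivFin ι).symm
  let σ := Tuple.sort (fun i => -f i)
  have hσ : Monotone ((fun i => -f i) ∘ σ) := Tuple.monotone_sort _
  let e := σ.trans (Fintype.equivFin ι).symm
  have hanti : Antitone (q ∘ e) := fun i j hij => neg_le_neg_iff.1 (hσ hij)
  have hlist : (Finset.univ.val.map q).sort (· ≥ ·) = List.ofFn (q ∘ e) := by
    have h1 : Finset.univ.val.map q = ↑(List.ofFn (q ∘ e)) := by
      rw [← Fin.univ_val_map, ← Multiset.map_map, Multiset.map_univ_val_equiv]
    refine List.Perm.eq_of_pairwise (le := (· ≥ ·)) (fun a b _ _ h h' => le_antisymm h' h)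
      (Multiset.pairwise_sort _ _) ?_ ?_
    · rw [List.pairwise_ofFn]
      exact fun i j hij => hanti hij.le
    · rw [← Multiset.coe_eq_coe, Multiset.sort_eq, h1]
  refine ⟨e, fun j => ?_⟩
  simp only [sortedDesc]
  rw [hlist, List.getD_eq_getElem _ _ (by simp)]
  simp

theorem sortedDesc_of_card_le (q : ι → ℝ) {j : ℕ} (hj : Fintype.card ι ≤ j) :
    sortedDesc q j = 0 := by
  rw [sortedDesc, List.getD_eq_default]
  simpa using hj

theorem sortedDesc_nonneg {q : ι → ℝ} (hq : ∀ i, 0 ≤ q i) (j : ℕ) : 0 ≤ sortedDesc q j := by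
  obtain ⟨e, he⟩ := exists_equiv_sortedDesc q
  rcases lt_or_ge j (Fintype.card ι) with h | h
  · rw [show j = ((⟨j, h⟩ : Fin _) : ℕ) from rfl, he]
    exact hq _
  · rw [sortedDesc_of_card_le q h]

theorem sortedDesc_antitone {q : ι → ℝ} (hq : ∀ i, 0 ≤ q i) : Antitone (sortedDesc q) := by
  intro i j hij
  rcases lt_or_ge j (Fintype.card ι) with h | h
  · have hlen : ((Finset.univ.val.map q).sort (· ≥ ·)).length = Fintype.card ι := by simp
    have hs := (Multiset.pairwise_sort (Finset.univ.val.map q) (· ≥ ·))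
    rcases hij.eq_or_lt with rfl | hlt
    · exact le_rfl
    · simp only [sortedDesc]
      rw [List.getD_eq_getElem _ _ (by omega), List.getD_eq_getElem _ _ (by omega)]
      exact List.pairwise_iff_getElem.1 hs i j (by omega) (by omega) hlt
  · rw [sortedDesc_of_card_le q h]
    exact sortedDesc_nonneg hq i

theorem sortedDesc_of_distRank_le {q : ι → ℝ} (hq : ∀ i, 0 ≤ q i) {j : ℕ}
    (hj : distRank q ≤ j) : sortedDesc q j = 0 := by
  classical
  rcases lt_or_ge j (Fintype.card ι) with h | h
  swap
  · exact sortedDesc_of_card_le q h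
  by_contra hne
  obtain ⟨e, he⟩ := exists_equiv_sortedDesc q
  have hpos : 0 < sortedDesc q j := lt_of_le_of_ne (sortedDesc_nonneg hq j) (Ne.symm hne)
  -- A nonzero entry at position j makes all j + 1 entries up to it nonzero, so the rank would
  -- exceed j.
  let g : Fin (j + 1) → {i // q i ≠ 0} := fun k => ⟨e ⟨k, by omega⟩, by
    have h1 : sortedDesc q j ≤ sortedDesc q k := sortedDesc_antitone hq (by omega)
    have h2 := he ⟨k, by omega⟩
    simp only at h2
    rw [← h2]
    exact (hpos.trans_le h1).ne'⟩
  have hg : Function.Injective g := by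
    intro a b hab
    have := e.injective (congrArg Subtype.val hab)
    exact Fin.ext (by simpa using this)
  have := Nat.card_le_card_of_injective g hg
  rw [Nat.card_eq_fintype_card, Fintype.card_fin] at this
  simp only [distRank] at hj
  omega

end Sorting

/-- The sum of the square roots of the entries of `q` over the `i`-th block of length `D` of its
decreasing rearrangement. -/
noncomputable def blockSum {ι : Type*} [Fintype ι] (q : ι → ℝ) (D i : ℕ) : ℝ :=
  ∑ j ∈ Finset.Ico (i * D) ((i + 1) * D), √(sortedDesc q j)

section BlockSum

variable {ι : Type*} [Fintype ι] {q : ι → ℝ}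

theorem blockSum_nonneg (q : ι → ℝ) (D i : ℕ) : 0 ≤ blockSum q D i :=
  Finset.sum_nonneg fun _ _ => Real.sqrt_nonneg _

theorem blockSum_eq_sum_range (q : ι → ℝ) (D i : ℕ) :
    blockSum q D i = ∑ l ∈ Finset.range D, √(sortedDesc q (i * D + l)) := by
  rw [blockSum, Finset.sum_Ico_eq_sum_range]
  congr 2
  rw [add_mul, one_mul, Nat.add_sub_cancel_left]

theorem blockSum_antitone (hq : ∀ i, 0 ≤ q i) (D : ℕ) : Antitone (blockSum q D) := by
  intro i j hij
  rw [blockSum_eq_sum_range, blockSum_eq_sum_range]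
  exact Finset.sum_le_sum fun l _ => Real.sqrt_le_sqrt (sortedDesc_antitone hq (by gcongr))

theorem blockSum_eq_zero (hq : ∀ i, 0 ≤ q i) {D i : ℕ} (h : distRank q ≤ i * D) :
    blockSum q D i = 0 := by
  refine Finset.sum_eq_zero fun j hj => ?_
  rw [sortedDesc_of_distRank_le hq (h.trans (Finset.mem_Ico.1 hj).1), Real.sqrt_zero]

theorem sum_range_blockSum (q : ι → ℝ) (D l : ℕ) :
    ∑ k ∈ Finset.range l, blockSum q D k = ∑ j ∈ Finset.range (l * D), √(sortedDesc q j) := by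
  induction l with
  | zero => simp
  | succ l ih =>
    rw [Finset.sum_range_succ, ih, blockSum, Finset.range_eq_Ico, Finset.range_eq_Ico,
      Finset.sum_Ico_consecutive _ (Nat.zero_le _) (by gcongr; omega)]

end BlockSum

/-! ### Substochastic weights -/

/-- Weights between `0` and `1` of total mass at most `M` capture at most the first `M` terms of a
decreasing sequence. -/
theorem sum_mul_le_sum_range {N M : ℕ} {t : ℕ → ℝ} (ht : Antitone t) (ht0 : ∀ j, 0 ≤ t j)
    {w : Fin N → ℝ} (hw0 : ∀ j, 0 ≤ w j) (hw1 : ∀ j, w j ≤ 1) (hw : ∑ j, w j ≤ M) :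
    ∑ j, w j * t j ≤ ∑ j ∈ Finset.range M, t j := by
  -- Shifting by the threshold t M makes every term from position M on nonpositive; the mass bound
  -- on w pays for the shift at the end.
  have h1 : ∑ j, w j * (t j - t M) ≤ ∑ j ∈ Finset.range M, (t j - t M) := by
    calc ∑ j, w j * (t j - t M) ≤ ∑ j : Fin N, if (j : ℕ) < M then t j - t M else 0 := by
          refine Finset.sum_le_sum fun j _ => ?_
          split_ifs with h
          · exact mul_le_of_le_one_left (sub_nonneg.2 (ht h.le)) (hw1 j)
          · exact mul_nonpos_of_nonneg_of_nonpos (hw0 j) (sub_nonpos.2 (ht (not_lt.1 h)))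
      _ = ∑ j ∈ (Finset.range N).filter (· < M), (t j - t M) := by
          rw [Finset.sum_filter, ← Fin.sum_univ_eq_sum_range
            (fun j => if j < M then t j - t M else 0)]
      _ ≤ _ := by
          refine Finset.sum_le_sum_of_subset_of_nonneg
            (fun j hj => Finset.mem_range.2 (Finset.mem_filter.1 hj).2) fun j hj _ => ?_
          exact sub_nonneg.2 (ht (Finset.mem_range.1 hj).le)
  simp only [mul_sub, Finset.sum_sub_distrib, ← Finset.sum_mul, Finset.sum_const,
    Finset.card_range, nsmul_eq_mul] at h1
  nlinarith [mul_le_mul_of_nonneg_right hw (ht0 M)]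

/-- Summation by parts: a decreasing nonnegative sequence pairs nonnegatively with a sequence whose
partial sums are nonnegative. -/
theorem sum_mul_nonneg_of_antitone {b δ : ℕ → ℝ} (hb : Antitone b) (hb0 : ∀ k, 0 ≤ b k) {a : ℕ}
    (hδ : ∀ l ≤ a, 0 ≤ ∑ k ∈ Finset.range l, δ k) :
    0 ≤ ∑ k ∈ Finset.range a, b k * δ k := by
  -- Nonnegativity alone does not pass through the induction; this stronger lower bound does.
  have key : ∀ l ≤ a, b l * ∑ k ∈ Finset.range l, δ k ≤ ∑ k ∈ Finset.range l, b k * δ k := by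
    intro l
    induction l with
    | zero => simp
    | succ l ih =>
      intro hl
      have h1 := ih (by omega)
      have h2 := mul_le_mul_of_nonneg_right (hb (Nat.le_succ l)) (hδ (l + 1) hl)
      refine h2.trans ?_
      rw [Finset.sum_range_succ, Finset.sum_range_succ, mul_add]
      linarith
  exact (mul_nonneg (hb0 a) (hδ a le_rfl)).trans (key a le_rfl)

/-- If `β` is dominated by the image of `√q` under a nonnegative matrix with row sums at most `D`
and column sums at most `1`, then the sum of the squares of `β` is at most that of the sums of `√q`
over the blocks of length `D`. -/
theorem sum_sq_le_sum_blockSum_sq {S J : Type*} [Fintype S] [Fintype J] (D : ℕ)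
    {β : S → ℝ} (hβ : ∀ s, 0 ≤ β s) {q : J → ℝ} (hq : ∀ j, 0 ≤ q j)
    {N : S → J → ℝ} (hN : ∀ s j, 0 ≤ N s j) (hrow : ∀ s, ∑ j, N s j ≤ D)
    (hcol : ∀ j, ∑ s, N s j ≤ 1) (hle : ∀ s, β s ≤ ∑ j, N s j * √(q j)) :
    ∑ s, β s ^ 2 ≤ ∑ k ∈ Finset.range (Fintype.card S), blockSum q D k ^ 2 := by
  set a := Fintype.card S
  obtain ⟨e, he⟩ : ∃ e : Fin a ≃ S, ∀ j : Fin a, sortedDesc β (j : ℕ) = β (e j) :=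
    exists_equiv_sortedDesc β
  obtain ⟨f, hf⟩ := exists_equiv_sortedDesc q
  -- The rows of N in decreasing order of β, continued by zero.
  let N' : ℕ → J → ℝ := fun k j => if h : k < a then N (e ⟨k, h⟩) j else 0
  have hN'e : ∀ (k : Fin a) j, N' k j = N (e k) j := fun k j => by simp [N']
  have hN' : ∀ k j, 0 ≤ N' k j := by
    intro k j
    simp only [N']
    split_ifs
    · exact hN _ _
    · exact le_rfl
  have hrow' : ∀ k, ∑ j, N' k j ≤ D := by
    intro k
    by_cases h : k < a
    · simpa [N', h] using hrow _
    · simp [N', h]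
  have hcol' : ∀ l ≤ a, ∀ j, ∑ k ∈ Finset.range l, N' k j ≤ 1 := by
    intro l hl j
    calc ∑ k ∈ Finset.range l, N' k j ≤ ∑ k ∈ Finset.range a, N' k j :=
          Finset.sum_le_sum_of_subset_of_nonneg (Finset.range_mono hl) fun _ _ _ => hN' _ _
      _ = ∑ s, N s j := by
          rw [← Fin.sum_univ_eq_sum_range (fun k => N' k j), ← e.sum_comp]
          exact Finset.sum_congr rfl fun k _ => hN'e k j
      _ ≤ 1 := hcol j
  let γ : ℕ → ℝ := fun k => ∑ j, N' k j * √(q j)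
  -- The first l rows together put weight at most 1 on each column and at most l * D in all, so they
  -- capture at most the l * D largest √q.
  have hγ : ∀ l ≤ a, 0 ≤ ∑ k ∈ Finset.range l, (blockSum q D k - γ k) := by
    intro l hl
    rw [Finset.sum_sub_distrib, sub_nonneg, sum_range_blockSum, Finset.sum_comm]
    simp only [← Finset.sum_mul]
    rw [← f.sum_comp]
    simp only [← hf]
    refine sum_mul_le_sum_range (t := fun j => √(sortedDesc q j))
      (fun i j hij => Real.sqrt_le_sqrt (sortedDesc_antitone hq hij))
      (fun j => Real.sqrt_nonneg _) (fun j => Finset.sum_nonneg fun _ _ => hN' _ _)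
      (fun j => hcol' l hl _) ?_
    rw [f.sum_comp (fun j => ∑ k ∈ Finset.range l, N' k j), Finset.sum_comm]
    calc ∑ k ∈ Finset.range l, ∑ j, N' k j ≤ ∑ k ∈ Finset.range l, (D : ℝ) :=
          Finset.sum_le_sum fun k _ => hrow' k
      _ = _ := by simp
  have hmain := sum_mul_nonneg_of_antitone (sortedDesc_antitone hβ) (sortedDesc_nonneg hβ) hγ
  have hsum : ∑ s, β s ^ 2 = ∑ k ∈ Finset.range a, sortedDesc β k ^ 2 := by
    rw [← Fin.sum_univ_eq_sum_range (fun k => sortedDesc β k ^ 2), ← e.sum_comp]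
    exact Finset.sum_congr rfl fun k _ => by rw [he]
  have hbγ : ∑ k ∈ Finset.range a, sortedDesc β k ^ 2 ≤
      ∑ k ∈ Finset.range a, sortedDesc β k * γ k := by
    refine Finset.sum_le_sum fun k hk => ?_
    rw [sq]
    refine mul_le_mul_of_nonneg_left ?_ (sortedDesc_nonneg hβ k)
    have h1 := he ⟨k, Finset.mem_range.1 hk⟩
    have h2 := hle (e ⟨k, Finset.mem_range.1 hk⟩)
    simp only at h1
    rw [h1]
    refine h2.trans (le_of_eq (Finset.sum_congr rfl fun j _ => ?_))
    rw [← hN'e]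
  -- With b the block sums, ∑ β² ≤ ∑ β γ ≤ ∑ β b ≤ (∑ β² + ∑ b²) / 2, and half of ∑ β² cancels.
  have hyoung : ∑ k ∈ Finset.range a, sortedDesc β k * blockSum q D k ≤
      ∑ k ∈ Finset.range a, (sortedDesc β k ^ 2 + blockSum q D k ^ 2) / 2 :=
    Finset.sum_le_sum fun k _ => by
      linarith [two_mul_le_add_sq (sortedDesc β k) (blockSum q D k)]
  rw [← Finset.sum_div, Finset.sum_add_distrib] at hyoung
  simp only [mul_sub, Finset.sum_sub_distrib] at hmain
  rw [hsum]
  linarith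

/-! ### The program over decreasing distributions -/

theorem convex_decreasingDist (K : ℕ) : Convex ℝ (decreasingDist K) := by
  rintro x ⟨hx0, hx1, hx⟩ y ⟨hy0, hy1, hy⟩ a b ha hb hab
  refine ⟨fun i => ?_, ?_, fun i j hij => ?_⟩
  · exact add_nonneg (mul_nonneg ha (hx0 i)) (mul_nonneg hb (hy0 i))
  · simp only [Pi.add_apply, Pi.smul_apply, smul_eq_mul, Finset.sum_add_distrib,
      ← Finset.mul_sum, hx1, hy1, mul_one, hab]
  · exact add_le_add (mul_le_mul_of_nonneg_left (hx hij) ha)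
      (mul_le_mul_of_nonneg_left (hy hij) hb)

theorem convexOn_neg_sum_mul_sqrt {K : ℕ} {c : ℕ → ℝ} (hc : ∀ i, 0 ≤ c i) :
    ConvexOn ℝ (decreasingDist K) (fun q : Fin K → ℝ => -∑ i : Fin K, c i * √(q i)) := by
  refine ⟨convex_decreasingDist K, fun x hx y hy a b ha hb hab => ?_⟩
  simp only [smul_eq_mul, mul_neg, ← neg_add, neg_le_neg_iff, Finset.mul_sum,
    ← Finset.sum_add_distrib]
  refine Finset.sum_le_sum fun i _ => ?_
  have h := Real.strictConcaveOn_sqrt.concaveOn.2 (hx.1 i) (hy.1 i) ha hb hab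
  simp only [smul_eq_mul] at h
  calc a * (c i * √(x i)) + b * (c i * √(y i)) = c i * (a * √(x i) + b * √(y i)) := by ring
    _ ≤ _ := mul_le_mul_of_nonneg_left h (hc i)

/-- For decreasing nonnegative coefficients the ordering constraint is inactive, and the optimum
is given by the Cauchy-Schwarz inequality. -/
theorem isLeast_neg_sum_mul_sqrt {K : ℕ} {c : ℕ → ℝ} (hc : ∀ i, 0 ≤ c i) (hanti : Antitone c)
    (hpos : 0 < ∑ i ∈ Finset.range K, c i ^ 2) :
    IsLeast ((fun q : Fin K → ℝ => -∑ i : Fin K, c i * √(q i)) '' decreasingDist K)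
      (-√(∑ i ∈ Finset.range K, c i ^ 2)) := by
  set s := ∑ i ∈ Finset.range K, c i ^ 2
  have hs : ∑ i : Fin K, c i ^ 2 = s := Fin.sum_univ_eq_sum_range (fun i => c i ^ 2) K
  constructor
  -- The equality case of Cauchy-Schwarz; it inherits its monotonicity from c.
  · refine ⟨fun i => c i ^ 2 / s, ⟨fun i => by positivity, ?_, fun i j hij => ?_⟩, ?_⟩
    · rw [← Finset.sum_div, hs, div_self hpos.ne']
    · have := hanti (Fin.le_def.1 hij)
      have := hc j
      dsimp only
      gcongr
    · have h : ∀ i : Fin K, c i * √(c i ^ 2 / s) = c i ^ 2 / √s := fun i => by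
        rw [Real.sqrt_div (sq_nonneg _), Real.sqrt_sq (hc i)]
        ring
      simp only [h]
      rw [← Finset.sum_div, hs, Real.div_sqrt]
  · rintro _ ⟨q, hq, rfl⟩
    refine neg_le_neg (Real.le_sqrt_of_sq_le ?_)
    refine (Finset.sum_mul_sq_le_sq_mul_sq _ _ _).trans ?_
    simp only [Real.sq_sqrt (hq.1 _), hq.2.1, hs, mul_one, le_refl]

/-! ### Block sums of the product distribution -/

section Distillation

variable {κ : Type*} {p : κ → ℝ}

theorem productDist_nonneg (hp : ∀ i, 0 ≤ p i) (n : ℕ) (x : Fin n → κ) : 0 ≤ productDist p n x :=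
  Finset.prod_nonneg fun _ _ => hp _

theorem sum_productDist [Fintype κ] (hp : ∑ i, p i = 1) (n : ℕ) : ∑ x, productDist p n x = 1 := by
  have h := (Finset.prod_univ_sum (fun _ : Fin n => Finset.univ) (fun _ i => p i)).symm
  simpa [productDist, hp] using h

theorem distRank_productDist (p : κ → ℝ) (n : ℕ) :
    distRank (productDist p n) = distRank p ^ n := by
  have e : {x // productDist p n x ≠ 0} ≃ (Fin n → {i // p i ≠ 0}) :=
    { toFun := fun x t => ⟨x.1 t, Finset.prod_ne_zero_iff.1 x.2 t (Finset.mem_univ _)⟩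
      invFun := fun x => ⟨fun t => x t, Finset.prod_ne_zero_iff.2 fun t _ => (x t).2⟩
      left_inv := fun _ => rfl
      right_inv := fun _ => rfl }
  rw [distRank, Nat.card_congr e, Nat.card_fun, Nat.card_fin, distRank]

theorem distRank_pow_le {d m n i : ℕ} (hd : 0 < d) (h : numBlocks p d m n ≤ i) :
    distRank (productDist p n) ≤ i * d ^ m := by
  rw [numBlocks, Nat.ceil_le, div_le_iff₀ (by positivity)] at h
  rw [distRank_productDist]
  exact_mod_cast h

/-- Cutting the last block at the rank changes nothing, since the sorted entries vanish from there
on. -/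
theorem blockCoeff_eq_blockSum [Fintype κ] (hp : ∀ i, 0 ≤ p i) (d m n i : ℕ) :
    blockCoeff p d m n i = blockSum (productDist p n) (d ^ m) i := by
  rw [blockCoeff, blockSum]
  refine Finset.sum_subset (Finset.Ico_subset_Ico_right (min_le_left _ _)) fun j hj hj' => ?_
  rw [sortedDesc_of_distRank_le (productDist_nonneg hp n), Real.sqrt_zero]
  rw [distRank_productDist]
  simp only [Finset.mem_Ico, lt_min_iff, not_and, not_lt] at hj hj'
  exact hj' hj.1 hj.2

theorem distillationObjective_eq [Fintype κ] (hp : ∀ i, 0 ≤ p i) {d : ℕ} (hd : 0 < d) (m n K : ℕ) :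
    distillationObjective p d m n K =
      fun q => -∑ i : Fin K, blockSum (productDist p n) (d ^ m) i * √(q i) := by
  funext q
  rw [distillationObjective, Finset.sum_filter]
  congr 1
  refine Finset.sum_congr rfl fun i _ => ?_
  split_ifs with h
  · rw [blockCoeff_eq_blockSum hp]
  · rw [blockSum_eq_zero (productDist_nonneg hp n) (distRank_pow_le hd (not_lt.1 h)), zero_mul]

/-- Needed to normalize the squared block sums to a probability distribution. -/
theorem sum_blockSum_sq_pos {J : Type*} [Fintype J] {q : J → ℝ} (hq : ∀ j, 0 ≤ q j)
    (hsum : ∑ j, q j = 1) {D K : ℕ} (hK : distRank q ≤ K * D) :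
    0 < ∑ i ∈ Finset.range K, blockSum q D i ^ 2 := by
  obtain ⟨e, he⟩ := exists_equiv_sortedDesc q
  have h0 : 0 < sortedDesc q 0 := by
    by_contra h
    have hz : ∀ j, q j = 0 := fun j => by
      refine le_antisymm ?_ (hq j)
      have := he (e.symm j)
      rw [e.apply_symm_apply] at this
      rw [← this]
      exact (sortedDesc_antitone hq (Nat.zero_le _)).trans (not_lt.1 h)
    simp [hz] at hsum
  have hr : 0 < distRank q := by
    by_contra h
    exact h0.ne' (sortedDesc_of_distRank_le hq (not_lt.1 h))
  have hK0 : 0 < K * D := hr.trans_le hK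
  have hK1 : 0 < K := Nat.pos_of_mul_pos_right hK0
  have hD : 0 < D := Nat.pos_of_mul_pos_left hK0
  have hb : 0 < blockSum q D 0 := by
    rw [blockSum_eq_sum_range]
    refine Finset.sum_pos' (fun _ _ => Real.sqrt_nonneg _) ⟨0, Finset.mem_range.2 hD, ?_⟩
    simpa using h0
  exact Finset.sum_pos' (fun _ _ => sq_nonneg _) ⟨0, Finset.mem_range.2 hK1, by positivity⟩

end Distillation

/-! ### Kraus families -/

/-- The completely positive map `X ↦ ∑ i, K i X (K i)†`. -/
def krausMap {ι α γ : Type*} [Fintype ι] [Fintype α] (K : ι → Matrix γ α ℂ) :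
    Matrix α α ℂ →ₗ[ℂ] Matrix γ γ ℂ where
  toFun X := ∑ i, K i * X * (K i).conjTranspose
  map_add' X Y := by simp [Matrix.mul_add, Matrix.add_mul, Finset.sum_add_distrib]
  map_smul' c X := by simp [Finset.smul_sum]

section Kraus

variable {ι α γ : Type*} [Fintype ι] [Fintype α]

theorem krausMap_apply (K : ι → Matrix γ α ℂ) (X : Matrix α α ℂ) :
    krausMap K X = ∑ i, K i * X * (K i).conjTranspose := rfl

theorem trace_krausMap [Fintype γ] (K : ι → Matrix γ α ℂ) (X : Matrix α α ℂ) :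
    (krausMap K X).trace = ((∑ i, (K i).conjTranspose * K i) * X).trace := by
  rw [krausMap_apply, Matrix.trace_sum, Finset.sum_mul, Matrix.trace_sum]
  exact Finset.sum_congr rfl fun i _ => by rw [Matrix.trace_mul_cycle]

theorem isChannel_krausMap [Fintype γ] [DecidableEq α] {K : ι → Matrix γ α ℂ}
    (hK : ∑ i, (K i).conjTranspose * K i = 1) : IsChannel (krausMap K) where
  completelyPositive k X hX := by
    -- These are 1 ⊗ K i, so the ampliation is again a sum of congruences.
    let L : ι → Matrix (Fin k × γ) (Fin k × α) ℂ := fun i =>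
      Matrix.of fun x y => if x.1 = y.1 then K i x.2 y.2 else 0
    have h : ampliation k (krausMap K) X = ∑ i, L i * X * (L i).conjTranspose := by
      ext ⟨s, c⟩ ⟨t, c'⟩
      simp [ampliation, krausMap_apply, Matrix.sum_apply, Matrix.mul_apply, L,
        Fintype.sum_prod_type, apply_ite, Finset.sum_ite_irrel, ite_mul]
    rw [h]
    exact Matrix.posSemidef_sum _ fun i _ => hX.mul_mul_conjTranspose_same _
  tracePreserving X := by rw [trace_krausMap, hK, one_mul]

/-- Every channel has a Kraus representation. -/
theorem IsChannel.exists_krausMap [Fintype γ] [DecidableEq α]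
    {E : Matrix α α ℂ →ₗ[ℂ] Matrix γ γ ℂ} (hE : IsChannel E) :
    ∃ (r : ℕ) (K : Fin r → Matrix γ α ℂ),
      ∑ i, (K i).conjTranspose * K i = 1 ∧ E = krausMap K := by
  let e := (Fintype.equivFin α).symm
  -- The unnormalized maximally entangled vector. The ampliation sends its projector to the Choi
  -- matrix of E, whose rank-one summands reshape into Kraus operators.
  let w : Fin (Fintype.card α) × α → ℂ := fun x => if e x.1 = x.2 then 1 else 0
  have hchoi := hE.completelyPositive _ _ (Matrix.posSemidef_vecMulVec_self_star w)
  obtain ⟨r, B, hB⟩ := Matrix.posSemidef_iff_eq_sum_vecMulVec.1 hchoi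
  let K : Fin r → Matrix γ α ℂ := fun i => Matrix.of fun c a => B i (e.symm a, c)
  have hEK : E = krausMap K := by
    refine Matrix.ext_linearMap ℂ fun a a' => LinearMap.ext_ring ?_
    ext c c'
    have h := congrFun (congrFun hB (e.symm a, c)) (e.symm a', c')
    have hw : (Matrix.of fun b b' => Matrix.vecMulVec w (star w) (e.symm a, b) (e.symm a', b')) =
        Matrix.single a a' (1 : ℂ) := by
      ext b b'
      simp [w, Matrix.vecMulVec_apply, Matrix.single_apply, ite_and]
      split_ifs <;> rfl
    change E (Matrix.of fun b b' =>
      Matrix.vecMulVec w (star w) (e.symm a, b) (e.symm a', b')) c c' = _ at h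
    rw [hw] at h
    simp only [LinearMap.comp_apply, Matrix.singleLinearMap_apply, krausMap_apply,
      Matrix.sum_apply, h]
    refine Finset.sum_congr rfl fun i _ => ?_
    simp [Matrix.mul_apply, Matrix.single_apply, K, Matrix.vecMulVec_apply, ite_and]
  refine ⟨r, K, ?_, hEK⟩
  rw [Matrix.ext_iff_trace_mul_right]
  intro X
  rw [← trace_krausMap, ← hEK, hE.tracePreserving, one_mul]

theorem star_dotProduct_sum_conjTranspose_mul_self [Fintype γ] (K : ι → Matrix γ α ℂ)
    (w : α → ℂ) :
    star w ⬝ᵥ (∑ i, (K i).conjTranspose * K i).mulVec w =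
      ((∑ i, ∑ c, ‖(K i).mulVec w c‖ ^ 2 : ℝ) : ℂ) := by
  rw [Matrix.sum_mulVec, dotProduct_sum, Complex.ofReal_sum]
  refine Finset.sum_congr rfl fun i _ => ?_
  rw [← Matrix.mulVec_mulVec, Matrix.dotProduct_mulVec, ← Matrix.star_mulVec, Complex.ofReal_sum]
  exact Finset.sum_congr rfl fun c _ => by
    rw [Pi.star_apply, Complex.star_def, Complex.conj_mul']; simp

theorem star_dotProduct_self_eq (w : α → ℂ) : star w ⬝ᵥ w = ((∑ a, ‖w a‖ ^ 2 : ℝ) : ℂ) := by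
  rw [Complex.ofReal_sum]
  exact Finset.sum_congr rfl fun c _ => by
    rw [Pi.star_apply, Complex.star_def, Complex.conj_mul']; simp

theorem sum_norm_sq_mulVec_eq [Fintype γ] [DecidableEq α] {K : ι → Matrix γ α ℂ}
    (hK : ∑ i, (K i).conjTranspose * K i = 1) (w : α → ℂ) :
    ∑ i, ∑ c, ‖(K i).mulVec w c‖ ^ 2 = ∑ a, ‖w a‖ ^ 2 := by
  have h := star_dotProduct_sum_conjTranspose_mul_self K w
  rw [hK, Matrix.one_mulVec, star_dotProduct_self_eq] at h
  exact_mod_cast h.symm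

/-- A contractive Kraus family can be completed to that of a channel. -/
theorem exists_kraus_completion [Fintype γ] [Nonempty γ] [DecidableEq α]
    {K : ι → Matrix γ α ℂ}
    (hK : ∀ w : α → ℂ, ∑ i, ∑ c, ‖(K i).mulVec w c‖ ^ 2 ≤ ∑ a, ‖w a‖ ^ 2) :
    ∃ (r : ℕ) (R : Fin r → Matrix γ α ℂ),
      ∑ i, (Sum.elim K R i).conjTranspose * Sum.elim K R i = 1 := by
  classical
  have hpos : (1 - ∑ i, (K i).conjTranspose * K i).PosSemidef := by
    refine Matrix.PosSemidef.of_dotProduct_mulVec_nonneg ?_ fun w => ?_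
    · refine Matrix.isHermitian_one.sub ?_
      rw [Matrix.IsHermitian, Matrix.conjTranspose_sum]
      exact Finset.sum_congr rfl fun i _ => Matrix.isHermitian_conjTranspose_mul_self _
    · rw [Matrix.sub_mulVec, dotProduct_sub, Matrix.one_mulVec, star_dotProduct_self_eq,
        star_dotProduct_sum_conjTranspose_mul_self, ← Complex.ofReal_sub]
      exact_mod_cast sub_nonneg.2 (hK w)
  obtain ⟨r, B, hB⟩ := Matrix.posSemidef_iff_eq_sum_vecMulVec.1 hpos
  obtain ⟨c⟩ := ‹Nonempty γ›
  -- The defect 1 - ∑ K†K is a sum of |B⟩⟨B|; the operators |c⟩⟨B| with one fixed basis vector c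
  -- supply exactly these terms.
  refine ⟨r, fun i => Matrix.vecMulVec (Pi.single c 1) (star (B i)), ?_⟩
  rw [Fintype.sum_sum_type]
  simp only [Sum.elim_inl, Sum.elim_inr]
  have h : ∀ i, (Matrix.vecMulVec (Pi.single c (1 : ℂ)) (star (B i))).conjTranspose *
      Matrix.vecMulVec (Pi.single c (1 : ℂ)) (star (B i)) =
      Matrix.vecMulVec (B i) (star (B i)) := fun i => by
    rw [Matrix.conjTranspose_vecMulVec, Matrix.vecMulVec_mul_vecMulVec]
    simp
  simp only [h]
  rw [← hB, add_sub_cancel]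

end Kraus

/-! ### Fidelity with a pure state -/

theorem density_eq_vecMulVec {α β : Type*} (ψ : Bipartite α β) :
    density ψ = Matrix.vecMulVec ψ (star ψ.ofLp) := rfl

/-- As |η⟩⟨η| is ‖η‖² times a projection, its root is |η⟩⟨η| / ‖η‖; for η = 0 the convention 0⁻¹ = 0
keeps the formula valid. -/
theorem trace_sqrt_vecMulVec {ι : Type*} [Fintype ι] [DecidableEq ι] (η : ι → ℂ) :
    (CFC.sqrt (Matrix.vecMulVec η (star η))).trace = ((√(∑ i, ‖η i‖ ^ 2) : ℝ) : ℂ) := by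
  set N := ∑ i, ‖η i‖ ^ 2
  have hN : 0 ≤ N := Finset.sum_nonneg fun _ _ => sq_nonneg _
  have hη : star η ⬝ᵥ η = (N : ℂ) := star_dotProduct_self_eq η
  have hpos : 0 ≤ Matrix.vecMulVec η (star η) :=
    (Matrix.posSemidef_vecMulVec_self_star η).nonneg
  have hsqrt : CFC.sqrt (Matrix.vecMulVec η (star η)) =
      (((√N)⁻¹ : ℝ) : ℂ) • Matrix.vecMulVec η (star η) := by
    refine CFC.sqrt_unique ?_ (smul_nonneg (by exact_mod_cast by positivity) hpos)
    rw [smul_mul_smul_comm, Matrix.vecMulVec_mul_vecMulVec, hη]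
    rcases hN.eq_or_lt with h | h
    · have : η = 0 := by
        rw [← dotProduct_star_self_eq_zero (v := η), hη, ← h, Complex.ofReal_zero]
      simp [this]
    · rw [Matrix.vecMulVec_smul, smul_smul, ← Complex.ofReal_mul, ← Complex.ofReal_mul,
        ← mul_inv, Real.mul_self_sqrt hN, inv_mul_cancel₀ h.ne', Complex.ofReal_one, one_smul]
  rw [hsqrt, Matrix.trace_smul, Matrix.trace_vecMulVec, dotProduct_comm, hη, smul_eq_mul,
    ← Complex.ofReal_mul, inv_mul_eq_div, Real.div_sqrt]

/-- `F(|φ⟩⟨φ|, S) = ⟨φ|S|φ⟩`. -/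
theorem fidelity_density {α β : Type*} [Fintype α] [Fintype β] [DecidableEq α] [DecidableEq β]
    (φ : Bipartite α β) {S : Matrix (α × β) (α × β) ℂ} (hS : S.PosSemidef) :
    fidelity (density φ) S = (star φ.ofLp ⬝ᵥ S.mulVec φ).re := by
  set T := CFC.sqrt S
  have hT : T.conjTranspose = T :=
    (Matrix.nonneg_iff_posSemidef.1 (CFC.sqrt_nonneg S)).isHermitian
  have hTT : T * T = S := CFC.sqrt_mul_sqrt_self S hS.nonneg
  -- Rank one again, so the fidelity is ‖Tφ‖² = ⟨φ|T²|φ⟩.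
  have h : T * density φ * T = Matrix.vecMulVec (T.mulVec φ) (star (T.mulVec φ)) := by
    rw [density_eq_vecMulVec, Matrix.mul_vecMulVec, Matrix.vecMulVec_mul, Matrix.star_mulVec, hT]
  rw [fidelity, h, trace_sqrt_vecMulVec, Complex.ofReal_re, Real.sq_sqrt
    (Finset.sum_nonneg fun _ _ => sq_nonneg _), ← hTT, ← Matrix.mulVec_mulVec,
    Matrix.dotProduct_mulVec, ← hT, ← Matrix.star_mulVec, hT, star_dotProduct_self_eq,
    Complex.ofReal_re]

/-! ### Local Kraus operators -/

section Tensor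

variable {α β γ δ ι₁ ι₂ : Type*} [Fintype α] [Fintype β] [Fintype ι₁] [Fintype ι₂]

/-- Both sides are linear in ρ and agree on products, in particular on matrix units. -/
theorem tensorMap_krausMap [DecidableEq α] [DecidableEq β] (K : ι₁ → Matrix γ α ℂ) (L : ι₂ → Matrix δ β ℂ)
    (ρ : Matrix (α × β) (α × β) ℂ) :
    tensorMap (krausMap K) (krausMap L) ρ =
      krausMap (fun i : ι₁ × ι₂ => K i.1 ⊗ₖ L i.2) ρ := by
  have hprod : ∀ X Y, krausMap K X ⊗ₖ krausMap L Y =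
      krausMap (fun i : ι₁ × ι₂ => K i.1 ⊗ₖ L i.2) (X ⊗ₖ Y) := fun X Y => by
    simp only [krausMap_apply, Fintype.sum_prod_type, Matrix.conjTranspose_kronecker,
      ← Matrix.mul_kronecker_mul]
    ext x y
    simp only [Matrix.kroneckerMap_apply, Matrix.sum_apply, Finset.sum_mul_sum]
  conv_rhs => rw [Matrix.matrix_eq_sum_single ρ]
  simp only [tensorMap, hprod, Matrix.single_kronecker_single, Fintype.sum_prod_type, map_sum,
    mul_one]
  refine Finset.sum_congr rfl fun a _ => ?_
  rw [Finset.sum_comm]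
  refine Finset.sum_congr rfl fun b _ => Finset.sum_congr rfl fun a' _ =>
    Finset.sum_congr rfl fun b' _ => ?_
  rw [← map_smul, Matrix.smul_single, smul_eq_mul, mul_one]

theorem krausMap_density (A : ι₁ → Matrix (γ × δ) (α × β) ℂ) (ψ : Bipartite α β) :
    krausMap A (density ψ) =
      ∑ i, Matrix.vecMulVec ((A i).mulVec ψ) (star ((A i).mulVec ψ)) := by
  rw [krausMap_apply]
  refine Finset.sum_congr rfl fun i _ => ?_
  rw [density_eq_vecMulVec, Matrix.mul_vecMulVec, Matrix.vecMulVec_mul, Matrix.star_mulVec]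

theorem fidelity_density_tensorMap_krausMap [DecidableEq α] [DecidableEq β] [Fintype γ]
    [Fintype δ] [DecidableEq γ] [DecidableEq δ] (K : ι₁ → Matrix γ α ℂ) (L : ι₂ → Matrix δ β ℂ)
    (φ : Bipartite γ δ) (ψ : Bipartite α β) :
    fidelity (density φ) (tensorMap (krausMap K) (krausMap L) (density ψ)) =
      ∑ k, ∑ l, ‖star φ.ofLp ⬝ᵥ (K k ⊗ₖ L l).mulVec ψ‖ ^ 2 := by
  rw [tensorMap_krausMap, krausMap_density, fidelity_density _
    (Matrix.posSemidef_sum _ fun i _ => Matrix.posSemidef_vecMulVec_self_star _),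
    Matrix.sum_mulVec, dotProduct_sum, Complex.re_sum, Fintype.sum_prod_type]
  refine Finset.sum_congr rfl fun k _ => Finset.sum_congr rfl fun l _ => ?_
  set χ := (K k ⊗ₖ L l).mulVec ψ
  have h : star χ ⬝ᵥ φ.ofLp = star (star φ.ofLp ⬝ᵥ χ) := by
    rw [Matrix.star_dotProduct]
  rw [Matrix.vecMulVec_mulVec, h]
  simp only [op_smul_eq_smul, dotProduct_smul, smul_eq_mul]
  rw [Complex.star_def, Complex.conj_mul', ← Complex.ofReal_pow, Complex.ofReal_re]

end Tensor

/-! ### Schmidt decompositions -/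

section Schmidt

variable {α β κ : Type*} [Fintype α] [Fintype β] [Fintype κ]

theorem IsSchmidtDecomposition.sqrt_eq {ψ : Bipartite α β} {p : κ → ℝ}
    {u : κ → EuclideanSpace ℂ α} {v : κ → EuclideanSpace ℂ β}
    (h : IsSchmidtDecomposition ψ p u v) (i : κ) :
    ((√(p i) : ℝ) : ℂ) = ∑ a, ∑ b, star (u i a) * star (v i b) * ψ (a, b) := by
  classical
  have hu : ∀ j, ∑ a, star (u i a) * u j a = if i = j then 1 else 0 := fun j => by
    rw [← orthonormal_iff_ite.1 h.orthonormal_left i j, EuclideanSpace.inner_eq_star_dotProduct,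
      dotProduct_comm]
    rfl
  have hv : ∀ j, ∑ a, star (v i a) * v j a = if i = j then 1 else 0 := fun j => by
    rw [← orthonormal_iff_ite.1 h.orthonormal_right i j, EuclideanSpace.inner_eq_star_dotProduct,
      dotProduct_comm]
    rfl
  calc ((√(p i) : ℝ) : ℂ) = ∑ j, ((√(p j) : ℝ) : ℂ) *
        ((∑ a, star (u i a) * u j a) * ∑ b, star (v i b) * v j b) := by
        simp only [hu, hv]
        simp
    _ = ∑ j, ∑ a, ∑ b, star (u i a) * star (v i b) * (((√(p j) : ℝ) : ℂ) * (u j a * v j b)) := by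
        refine Finset.sum_congr rfl fun j _ => ?_
        rw [Finset.sum_mul_sum, Finset.mul_sum]
        refine Finset.sum_congr rfl fun a _ => ?_
        rw [Finset.mul_sum]
        exact Finset.sum_congr rfl fun b _ => by ring
    _ = _ := by
        rw [Finset.sum_comm]
        refine Finset.sum_congr rfl fun a _ => ?_
        rw [Finset.sum_comm]
        exact Finset.sum_congr rfl fun b _ => by rw [h.eq_sum, Finset.mul_sum]

/-- Serves twice: it normalizes the Schmidt weights of the seed, and it turns the total squared
overlap into a sum of squared singular values. -/
theorem IsSchmidtDecomposition.sum_eq {ψ : Bipartite α β} {p : κ → ℝ}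
    {u : κ → EuclideanSpace ℂ α} {v : κ → EuclideanSpace ℂ β}
    (h : IsSchmidtDecomposition ψ p u v) : ∑ i, p i = ‖ψ‖ ^ 2 := by
  have key : ((∑ i, p i : ℝ) : ℂ) = ((‖ψ‖ ^ 2 : ℝ) : ℂ) := by
    calc ((∑ i, p i : ℝ) : ℂ) = ∑ i, ((√(p i) : ℝ) : ℂ) * star ((√(p i) : ℝ) : ℂ) := by
          rw [Complex.ofReal_sum]
          refine Finset.sum_congr rfl fun i _ => ?_
          rw [Complex.star_def, Complex.conj_ofReal, ← Complex.ofReal_mul,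
            Real.mul_self_sqrt (h.nonneg i)]
      _ = ∑ i, ∑ a, ∑ b, ((√(p i) : ℝ) : ℂ) * (u i a * v i b) * star (ψ (a, b)) := by
          refine Finset.sum_congr rfl fun i _ => ?_
          have hs := congrArg star (h.sqrt_eq i)
          simp only [star_sum, star_mul', star_star] at hs
          rw [hs]
          simp only [Finset.mul_sum, mul_assoc]
      _ = ∑ a, ∑ b, ψ (a, b) * star (ψ (a, b)) := by
          rw [Finset.sum_comm]
          refine Finset.sum_congr rfl fun a _ => ?_
          rw [Finset.sum_comm]
          exact Finset.sum_congr rfl fun b _ => by rw [h.eq_sum, Finset.sum_mul]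
      _ = _ := by
          rw [EuclideanSpace.norm_sq_eq, Complex.ofReal_sum, Fintype.sum_prod_type]
          refine Finset.sum_congr rfl fun a _ => Finset.sum_congr rfl fun b _ => ?_
          rw [Complex.star_def, Complex.mul_conj', Complex.ofReal_pow]
  exact_mod_cast key

end Schmidt

/-! ### Bounds for contractive families -/

section Contractive

variable {α γ ι S J : Type*} [Fintype α] [Fintype γ] [Fintype ι] [Fintype S] [Fintype J]

theorem sum_norm_sq_inner_le {u : J → EuclideanSpace ℂ α} (hu : Orthonormal ℂ u) (w : α → ℂ) :
    ∑ j, ‖∑ a, star (u j a) * w a‖ ^ 2 ≤ ∑ a, ‖w a‖ ^ 2 := by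
  have h := hu.sum_inner_products_le (WithLp.toLp 2 w) (s := Finset.univ)
  rw [EuclideanSpace.norm_sq_eq] at h
  refine le_trans (le_of_eq (Finset.sum_congr rfl fun j _ => ?_)) h
  rw [EuclideanSpace.inner_eq_star_dotProduct, dotProduct_comm]
  rfl

/-- Recombining a Kraus family with orthonormal coefficient vectors does not increase it. -/
theorem sum_norm_sq_mixture_le [DecidableEq α] {K : ι → Matrix γ α ℂ}
    (hK : ∑ i, (K i).conjTranspose * K i = 1) {x : S → EuclideanSpace ℂ ι}
    (hx : Orthonormal ℂ x) (w : α → ℂ) :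
    ∑ s, ∑ c, ‖(∑ i, star (x s i) • K i).mulVec w c‖ ^ 2 ≤ ∑ a, ‖w a‖ ^ 2 := by
  rw [← sum_norm_sq_mulVec_eq hK, Finset.sum_comm]
  -- For each output coordinate c, Bessel's inequality applies to the vector i ↦ (K i w) c.
  refine le_of_le_of_eq (Finset.sum_le_sum fun c _ => ?_) Finset.sum_comm
  refine le_trans (le_of_eq (Finset.sum_congr rfl fun s _ => ?_))
    (sum_norm_sq_inner_le hx fun i => (K i).mulVec w c)
  simp [Matrix.sum_mulVec, Matrix.smul_mulVec]

/-- A contraction into a space of dimension `D` has squared Hilbert-Schmidt norm at most `D`. -/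
theorem sum_norm_sq_mulVec_orthonormal_le {A : Matrix γ α ℂ}
    (hA : ∀ w : α → ℂ, ∑ c, ‖A.mulVec w c‖ ^ 2 ≤ ∑ a, ‖w a‖ ^ 2)
    {u : J → EuclideanSpace ℂ α} (hu : Orthonormal ℂ u) :
    ∑ j, ∑ c, ‖A.mulVec (u j) c‖ ^ 2 ≤ Fintype.card γ := by
  have hrow : ∀ c, ∑ a, ‖A c a‖ ^ 2 ≤ 1 := by
    intro c
    set N := ∑ a, ‖A c a‖ ^ 2
    have hN : 0 ≤ N := Finset.sum_nonneg fun _ _ => sq_nonneg _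
    -- Testing contractivity on the conjugated row gives N² ≤ N, hence N ≤ 1.
    have h1 : A.mulVec (star (A c)) c = (N : ℂ) := by
      simp only [Matrix.mulVec, dotProduct, Pi.star_apply, N, Complex.ofReal_sum,
        Complex.ofReal_pow]
      exact Finset.sum_congr rfl fun a _ => by rw [Complex.star_def, Complex.mul_conj']
    have h2 : ‖A.mulVec (star (A c)) c‖ ^ 2 ≤ N := by
      refine (Finset.single_le_sum (f := fun c' => ‖A.mulVec (star (A c)) c'‖ ^ 2)
        (fun _ _ => sq_nonneg _) (Finset.mem_univ c)).trans ((hA _).trans (le_of_eq ?_))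
      simp [N]
    rw [h1, Complex.norm_real, Real.norm_of_nonneg hN] at h2
    nlinarith
  rw [Finset.sum_comm]
  calc ∑ c, ∑ j, ‖A.mulVec (u j) c‖ ^ 2 ≤ ∑ c : γ, (1 : ℝ) := by
        refine Finset.sum_le_sum fun c _ => ?_
        refine le_trans (le_of_eq (Finset.sum_congr rfl fun j _ => ?_))
          ((sum_norm_sq_inner_le hu (star (A c))).trans (le_of_eq_of_le ?_ (hrow c)))
        · rw [← norm_star (A.mulVec _ c)]
          simp only [Matrix.mulVec, dotProduct, star_sum, star_mul', Pi.star_apply]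
          congr 2
          exact Finset.sum_congr rfl fun a _ => mul_comm _ _
        · simp
    _ = _ := by simp

end Contractive

/-! ### Overlaps with a maximally entangled state -/

/-- The unnormalized overlap of `(A ⊗ B) ∑ j, √(p j) u j ⊗ v j` with `∑ c, |c⟩|c⟩`. -/
noncomputable def diagOverlap {α β γ J : Type*} [Fintype α] [Fintype β] [Fintype γ] [Fintype J]
    (p : J → ℝ) (u : J → EuclideanSpace ℂ α) (v : J → EuclideanSpace ℂ β)
    (A : Matrix γ α ℂ) (B : Matrix γ β ℂ) : ℂ :=
  ∑ j, ((√(p j) : ℝ) : ℂ) * ∑ c, A.mulVec (u j) c * B.mulVec (v j) c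

section Overlap

variable {α β γ J : Type*} [Fintype α] [Fintype β] [Fintype J] {p : J → ℝ}
  {u : J → EuclideanSpace ℂ α} {v : J → EuclideanSpace ℂ β}

theorem norm_diagOverlap_le [Fintype γ] (A : Matrix γ α ℂ) (B : Matrix γ β ℂ) :
    ‖diagOverlap p u v A B‖ ≤
      ∑ j, (∑ c, ‖A.mulVec (u j) c‖ ^ 2 + ∑ c, ‖B.mulVec (v j) c‖ ^ 2) / 2 * √(p j) := by
  refine (norm_sum_le _ _).trans (Finset.sum_le_sum fun j _ => ?_)
  rw [norm_mul, Complex.norm_real, Real.norm_of_nonneg (Real.sqrt_nonneg _), mul_comm]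
  refine mul_le_mul_of_nonneg_right ?_ (Real.sqrt_nonneg _)
  refine (norm_sum_le _ _).trans ?_
  rw [← Finset.sum_add_distrib, Finset.sum_div]
  refine Finset.sum_le_sum fun c _ => ?_
  rw [norm_mul]
  linarith [two_mul_le_add_sq ‖A.mulVec (u j) c‖ ‖B.mulVec (v j) c‖]

theorem sum_sum_sum_sum_comm {ι₁ ι₂ ι₃ ι₄ R : Type*} [Fintype ι₁] [Fintype ι₂] [Fintype ι₃]
    [Fintype ι₄] [AddCommMonoid R] (f : ι₁ → ι₂ → ι₃ → ι₄ → R) :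
    ∑ a, ∑ b, ∑ c, ∑ d, f a b c d = ∑ c, ∑ d, ∑ a, ∑ b, f a b c d := by
  have h := Finset.sum_comm (s := (Finset.univ : Finset (ι₁ × ι₂)))
    (t := (Finset.univ : Finset (ι₃ × ι₄))) (f := fun x y => f x.1 x.2 y.1 y.2)
  simpa only [Fintype.sum_prod_type] using h

theorem diagOverlap_sum_sum [Fintype γ] {ι₁ ι₂ : Type*} [Fintype ι₁] [Fintype ι₂] (x : ι₁ → ℂ) (y : ι₂ → ℂ)
    (K : ι₁ → Matrix γ α ℂ) (L : ι₂ → Matrix γ β ℂ) :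
    diagOverlap p u v (∑ k, x k • K k) (∑ l, y l • L l) =
      ∑ k, ∑ l, x k * y l * diagOverlap p u v (K k) (L l) := by
  simp only [diagOverlap, Matrix.sum_mulVec, Matrix.smul_mulVec, Finset.sum_apply, Pi.smul_apply,
    smul_eq_mul, Finset.sum_mul_sum]
  simp only [Finset.mul_sum]
  rw [sum_sum_sum_sum_comm]
  exact Finset.sum_congr rfl fun k _ => Finset.sum_congr rfl fun l _ =>
    Finset.sum_congr rfl fun j _ => Finset.sum_congr rfl fun c _ => by ring

/-- The total squared overlap that local Kraus families reach is at most the sum of the squares of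
the block sums of the Schmidt coefficients. -/
theorem sum_norm_sq_diagOverlap_le [Fintype γ] {ι₁ ι₂ : Type*} [Fintype ι₁] [Fintype ι₂] [DecidableEq α]
    [DecidableEq β] (hp : ∀ j, 0 ≤ p j) (hu : Orthonormal ℂ u) (hv : Orthonormal ℂ v)
    {K : ι₁ → Matrix γ α ℂ} (hK : ∑ k, (K k).conjTranspose * K k = 1)
    {L : ι₂ → Matrix γ β ℂ} (hL : ∑ l, (L l).conjTranspose * L l = 1)
    {M : ℕ} (hM : distRank p ≤ M * Fintype.card γ) :
    ∑ k, ∑ l, ‖diagOverlap p u v (K k) (L l)‖ ^ 2 ≤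
      ∑ i ∈ Finset.range M, blockSum p (Fintype.card γ) i ^ 2 := by
  -- The matrix of overlaps, read as a bipartite vector: its Schmidt decomposition is a singular
  -- value decomposition, with singular values √(c s).
  obtain ⟨S, c, x, y, h⟩ := exists_isSchmidtDecomposition
    (WithLp.toLp 2 fun kl => diagOverlap p u v (K kl.1) (L kl.2) : Bipartite ι₁ ι₂)
  have hsum := h.sum_eq
  rw [EuclideanSpace.norm_sq_eq, Fintype.sum_prod_type] at hsum
  have hA : ∀ w : α → ℂ, ∑ s, ∑ c, ‖(∑ i, star (x s i) • K i).mulVec w c‖ ^ 2 ≤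
      ∑ a, ‖w a‖ ^ 2 := sum_norm_sq_mixture_le hK h.orthonormal_left
  have hB : ∀ w : β → ℂ, ∑ s, ∑ c, ‖(∑ i, star (y s i) • L i).mulVec w c‖ ^ 2 ≤
      ∑ a, ‖w a‖ ^ 2 := sum_norm_sq_mixture_le hL h.orthonormal_right
  have hle : ∀ s, √(c s) ≤ ∑ j, (∑ e, ‖(∑ i, star (x s i) • K i).mulVec (u j) e‖ ^ 2 +
      ∑ e, ‖(∑ i, star (y s i) • L i).mulVec (v j) e‖ ^ 2) / 2 * √(p j) := by
    intro s
    refine le_of_eq_of_le ?_ (norm_diagOverlap_le _ _)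
    rw [diagOverlap_sum_sum, ← Real.norm_of_nonneg (Real.sqrt_nonneg _), ← Complex.norm_real,
      h.sqrt_eq s]
  have hmain := sum_sq_le_sum_blockSum_sq (Fintype.card γ) (fun s => Real.sqrt_nonneg (c s)) hp
    (fun s j => by positivity) (fun s => ?_) (fun j => ?_) hle
  · simp only [Real.sq_sqrt (h.nonneg _)] at hmain
    rw [hsum] at hmain
    refine hmain.trans ?_
    -- The number of singular values is unrelated to M, but block sums from M on vanish by `hM`.
    rcases le_total (Fintype.card S) M with hc | hc
    · exact Finset.sum_le_sum_of_subset_of_nonneg (Finset.range_mono hc) fun _ _ _ => sq_nonneg _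
    · refine le_of_eq (Finset.sum_subset (Finset.range_mono hc) fun i _ hi => ?_).symm
      rw [blockSum_eq_zero hp (hM.trans (Nat.mul_le_mul_right _ (by simpa using hi)))]
      simp
  · rw [← Finset.sum_div, Finset.sum_add_distrib]
    have h1 := sum_norm_sq_mulVec_orthonormal_le (A := ∑ i, star (x s i) • K i)
      (fun w => (Finset.single_le_sum (f := fun s => ∑ c,
        ‖(∑ i, star (x s i) • K i).mulVec w c‖ ^ 2) (fun _ _ => by positivity)
        (Finset.mem_univ s)).trans (hA w)) hu
    have h2 := sum_norm_sq_mulVec_orthonormal_le (A := ∑ i, star (y s i) • L i)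
      (fun w => (Finset.single_le_sum (f := fun s => ∑ c,
        ‖(∑ i, star (y s i) • L i).mulVec w c‖ ^ 2) (fun _ _ => by positivity)
        (Finset.mem_univ s)).trans (hB w)) hv
    linarith
  · rw [← Finset.sum_div, Finset.sum_add_distrib]
    have h1 := hA (u j)
    have h2 := hB (v j)
    have h3 : ∑ a, ‖u j a‖ ^ 2 = 1 := by rw [← EuclideanSpace.norm_sq_eq, hu.1 j, one_pow]
    have h4 : ∑ a, ‖v j a‖ ^ 2 = 1 := by rw [← EuclideanSpace.norm_sq_eq, hv.1 j, one_pow]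
    linarith

/-- Reading off the `i`-th block of `D` consecutive vectors: the row number `c` is the conjugate of
the vector number `i * D + c`. -/
noncomputable def blockReadout {D : ℕ} (e : γ ≃ Fin D) (f : Fin (Fintype.card J) ≃ J)
    (u : J → EuclideanSpace ℂ α) (i : ℕ) : Matrix γ α ℂ :=
  Matrix.of fun c a =>
    if h : i * D + e c < Fintype.card J then star (u (f ⟨i * D + e c, h⟩) a) else 0

/-- Distinct pairs (i, c) read off distinct vectors of u, or zero past the end, so this is Bessel's
inequality. -/
theorem sum_norm_sq_blockReadout_le [Fintype γ] {D : ℕ} (e : γ ≃ Fin D) (f : Fin (Fintype.card J) ≃ J)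
    (hu : Orthonormal ℂ u) (M : ℕ) (w : α → ℂ) :
    ∑ i : Fin M, ∑ c, ‖(blockReadout e f u i).mulVec w c‖ ^ 2 ≤ ∑ a, ‖w a‖ ^ 2 := by
  let g : ℕ → ℝ := fun j => if h : j < Fintype.card J then
    ‖∑ a, star (u (f ⟨j, h⟩) a) * w a‖ ^ 2 else 0
  have hg : ∀ j, 0 ≤ g j := fun j => by simp only [g]; split_ifs <;> positivity
  have hg0 : ∀ j, Fintype.card J ≤ j → g j = 0 := fun j hj => dif_neg (not_lt.2 hj)
  have h1 : ∀ (i : ℕ) c, ‖(blockReadout e f u i).mulVec w c‖ ^ 2 = g (i * D + e c) := by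
    intro i c
    simp only [blockReadout, Matrix.mulVec, dotProduct, Matrix.of_apply, g]
    split_ifs <;> simp
  calc ∑ i : Fin M, ∑ c, ‖(blockReadout e f u i).mulVec w c‖ ^ 2
      = ∑ i : Fin M, ∑ c : Fin D, g (i * D + c) := by
        refine Finset.sum_congr rfl fun i _ => ?_
        rw [← e.sum_comp]
        exact Finset.sum_congr rfl fun c _ => h1 i c
    _ = ∑ j ∈ Finset.range (M * D), g j := by
        rw [← Fin.sum_univ_eq_sum_range, ← finProdFinEquiv.sum_comp, Fintype.sum_prod_type]
        refine Finset.sum_congr rfl fun i _ => Finset.sum_congr rfl fun c _ => ?_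
        rw [finProdFinEquiv_apply_val, mul_comm D, add_comm]
    _ ≤ ∑ j ∈ Finset.range (max (M * D) (Fintype.card J)), g j :=
        Finset.sum_le_sum_of_subset_of_nonneg (Finset.range_mono (le_max_left _ _))
          fun _ _ _ => hg _
    _ = ∑ j ∈ Finset.range (Fintype.card J), g j :=
        (Finset.sum_subset (Finset.range_mono (le_max_right _ _)) fun j _ hj =>
          hg0 j (by simpa using hj)).symm
    _ = ∑ j, ‖∑ a, star (u j a) * w a‖ ^ 2 := by
        rw [← Fin.sum_univ_eq_sum_range, ← f.sum_comp]
        exact Finset.sum_congr rfl fun j _ => by simp [g]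
    _ ≤ _ := sum_norm_sq_inner_le hu w

theorem blockReadout_mulVec {D : ℕ} (e : γ ≃ Fin D) (f : Fin (Fintype.card J) ≃ J)
    (hu : Orthonormal ℂ u) (i : ℕ) (j : Fin (Fintype.card J)) (c : γ) :
    (blockReadout e f u i).mulVec (u (f j)) c = if i * D + e c = j then 1 else 0 := by
  classical
  simp only [blockReadout, Matrix.mulVec, dotProduct, Matrix.of_apply]
  by_cases h : i * D + e c < Fintype.card J
  · have := orthonormal_iff_ite.1 hu (f ⟨i * D + e c, h⟩) (f j)
    rw [EuclideanSpace.inner_eq_star_dotProduct, dotProduct_comm] at this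
    simp only [h, dif_pos]
    refine this.trans ?_
    simp only [f.injective.eq_iff, Fin.ext_iff]
  · have hne : i * D + e c ≠ j := fun h' => h (h' ▸ j.2)
    simp [h, hne]

/-- On both sides the Schmidt vectors of block i go to the same basis vectors and all others to
zero, so each √p in the block counts once. -/
theorem diagOverlap_blockReadout [Fintype γ] {D : ℕ} (e : γ ≃ Fin D) (f : Fin (Fintype.card J) ≃ J)
    (hf : ∀ j : Fin (Fintype.card J), sortedDesc p (j : ℕ) = p (f j))
    (hu : Orthonormal ℂ u) (hv : Orthonormal ℂ v) (i : ℕ) :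
    diagOverlap p u v (blockReadout e f u i) (blockReadout e f v i) = (blockSum p D i : ℝ) := by
  rw [diagOverlap, ← f.sum_comp]
  simp only [blockReadout_mulVec e f hu, blockReadout_mulVec e f hv, ← hf, mul_ite, mul_one,
    mul_zero, Finset.mul_sum]
  rw [Finset.sum_comm, blockSum_eq_sum_range, ← Fin.sum_univ_eq_sum_range
    (fun l => √(sortedDesc p (i * D + l))), ← e.sum_comp, Complex.ofReal_sum]
  refine Finset.sum_congr rfl fun c _ => ?_
  by_cases h : i * D + e c < Fintype.card J
  · rw [Finset.sum_eq_single ⟨i * D + e c, h⟩]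
    · simp
    · intro j _ hj
      have : i * D + e c ≠ j := fun h' => hj (Fin.ext h'.symm)
      simp [this]
    · simp
  · rw [sortedDesc_of_card_le p (not_lt.1 h), Real.sqrt_zero, Complex.ofReal_zero]
    refine Finset.sum_eq_zero fun j _ => ?_
    have : i * D + e c ≠ j := fun h' => h (h' ▸ j.2)
    simp [this]

end Overlap

/-! ### Conversion to a maximally entangled state -/

section Conversion

variable {α β γ J : Type*} [Fintype α] [Fintype β] [Fintype γ] [Fintype J] [DecidableEq γ]
  {ψ : Bipartite α β} {p : J → ℝ} {u : J → EuclideanSpace ℂ α} {v : J → EuclideanSpace ℂ β}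
  {φ : Bipartite γ γ} {c : ℝ}

theorem star_dotProduct_kronecker_mulVec (hψ : IsSchmidtDecomposition ψ p u v)
    (hφ : ∀ x y, φ (x, y) = if x = y then (c : ℂ) else 0)
    (A : Matrix γ α ℂ) (B : Matrix γ β ℂ) :
    star φ.ofLp ⬝ᵥ (A ⊗ₖ B).mulVec ψ = c * diagOverlap p u v A B := by
  have h : ∀ x, (A ⊗ₖ B).mulVec ψ (x, x) =
      ∑ j, ((√(p j) : ℝ) : ℂ) * (A.mulVec (u j) x * B.mulVec (v j) x) := by
    intro x
    simp only [Matrix.mulVec, dotProduct, Matrix.kroneckerMap_apply, Fintype.sum_prod_type,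
      hψ.eq_sum, Finset.sum_mul_sum]
    simp only [Finset.mul_sum]
    rw [Finset.sum_comm (s := (Finset.univ : Finset J))]
    refine Finset.sum_congr rfl fun a _ => ?_
    rw [Finset.sum_comm]
    exact Finset.sum_congr rfl fun j _ => Finset.sum_congr rfl fun b _ => by ring
  simp only [dotProduct, Fintype.sum_prod_type, Pi.star_apply, hφ, apply_ite star, star_zero,
    ite_mul, zero_mul, Finset.sum_ite_eq, Finset.mem_univ, if_true, h, Complex.star_def,
    Complex.conj_ofReal, diagOverlap]
  rw [← Finset.mul_sum, Finset.sum_comm]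
  simp only [Finset.mul_sum]

theorem fidelity_tensorMap_krausMap_eq [DecidableEq α] [DecidableEq β]
    {ι₁ ι₂ : Type*} [Fintype ι₁] [Fintype ι₂] (hψ : IsSchmidtDecomposition ψ p u v)
    (hφ : ∀ x y, φ (x, y) = if x = y then (c : ℂ) else 0)
    (K : ι₁ → Matrix γ α ℂ) (L : ι₂ → Matrix γ β ℂ) :
    fidelity (density φ) (tensorMap (krausMap K) (krausMap L) (density ψ)) =
      c ^ 2 * ∑ k, ∑ l, ‖diagOverlap p u v (K k) (L l)‖ ^ 2 := by
  rw [fidelity_density_tensorMap_krausMap]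
  simp only [star_dotProduct_kronecker_mulVec hψ hφ, norm_mul, Complex.norm_real, mul_pow,
    Real.norm_eq_abs, sq_abs, Finset.mul_sum]

/-- The optimal fidelity of converting a pure state to a maximally entangled state under local
operations, and its attainment. -/
theorem isGreatest_loFidelities [DecidableEq α] [DecidableEq β] [Nonempty γ]
    (hψ : IsSchmidtDecomposition ψ p u v)
    (hφ : ∀ x y, φ (x, y) = if x = y then (c : ℂ) else 0)
    {M : ℕ} (hM : distRank p ≤ M * Fintype.card γ) :
    IsGreatest (loFidelities (density φ) (density ψ))
      (c ^ 2 * ∑ i ∈ Finset.range M, blockSum p (Fintype.card γ) i ^ 2) := by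
  have hub : c ^ 2 * ∑ i ∈ Finset.range M, blockSum p (Fintype.card γ) i ^ 2 ∈
      upperBounds (loFidelities (density φ) (density ψ)) := by
    rintro _ ⟨E, F, hE, hF, rfl⟩
    obtain ⟨r, K, hK, rfl⟩ := hE.exists_krausMap
    obtain ⟨s, L, hL, rfl⟩ := hF.exists_krausMap
    rw [fidelity_tensorMap_krausMap_eq hψ hφ]
    exact mul_le_mul_of_nonneg_left (sum_norm_sq_diagOverlap_le hψ.nonneg hψ.orthonormal_left
      hψ.orthonormal_right hK hL hM) (sq_nonneg _)
  refine ⟨?_, hub⟩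
  obtain ⟨f, hf⟩ := exists_equiv_sortedDesc p
  let e := Fintype.equivFin γ
  obtain ⟨r, R, hR⟩ := exists_kraus_completion (K := fun i : Fin M => blockReadout e f u i)
    (sum_norm_sq_blockReadout_le e f hψ.orthonormal_left M)
  obtain ⟨s, Q, hQ⟩ := exists_kraus_completion (K := fun i : Fin M => blockReadout e f v i)
    (sum_norm_sq_blockReadout_le e f hψ.orthonormal_right M)
  have hmem : fidelity (density φ) (tensorMap (krausMap (Sum.elim _ R)) (krausMap (Sum.elim _ Q))
      (density ψ)) ∈ loFidelities (density φ) (density ψ) :=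
    ⟨_, _, isChannel_krausMap hR, isChannel_krausMap hQ, rfl⟩
  convert hmem using 1
  -- Only a lower bound is required of the strategy: the completing Kraus operators and mismatched
  -- outcomes contribute nonnegatively, and `hub` excludes any excess.
  refine le_antisymm ?_ (hub hmem)
  rw [fidelity_tensorMap_krausMap_eq hψ hφ]
  refine mul_le_mul_of_nonneg_left ?_ (sq_nonneg _)
  rw [← Fin.sum_univ_eq_sum_range (fun i => blockSum p (Fintype.card γ) i ^ 2),
    Fintype.sum_sum_type]
  refine le_add_of_le_of_nonneg (Finset.sum_le_sum fun i _ => ?_) (by positivity)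
  refine le_trans (le_of_eq ?_) (Finset.single_le_sum (fun _ _ => sq_nonneg _)
    (Finset.mem_univ (Sum.inl i)))
  simp only [Sum.elim_inl]
  rw [diagOverlap_blockReadout e f hf hψ.orthonormal_left hψ.orthonormal_right, Complex.norm_real,
    Real.norm_eq_abs, sq_abs]

end Conversion

/-! ### Tensor powers -/

section TensorPower

variable {α β κ : Type*} [Fintype α] [Fintype β]

/-- The product vector `u (x 0) ⊗ ⋯ ⊗ u (x (n - 1))`. -/
def productVector (u : κ → EuclideanSpace ℂ α) (n : ℕ) (x : Fin n → κ) :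
    EuclideanSpace ℂ (Fin n → α) :=
  WithLp.toLp 2 fun a => ∏ t, u (x t) (a t)

theorem orthonormal_productVector {u : κ → EuclideanSpace ℂ α} (hu : Orthonormal ℂ u) (n : ℕ) :
    Orthonormal ℂ (productVector u n) := by
  classical
  rw [orthonormal_iff_ite] at hu ⊢
  intro x y
  have h : inner ℂ (productVector u n x) (productVector u n y) =
      ∏ t, inner ℂ (u (x t)) (u (y t)) := by
    simp only [EuclideanSpace.inner_eq_star_dotProduct, dotProduct, productVector, Pi.star_apply,
      star_prod, ← Finset.prod_mul_distrib]
    rw [Finset.prod_univ_sum, Fintype.piFinset_univ]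
  simp only [h, hu]
  rw [Finset.prod_ite_zero]
  simp [funext_iff]

theorem IsSchmidtDecomposition.tensorPower [Fintype κ] {ψ : Bipartite α β} {p : κ → ℝ}
    {u : κ → EuclideanSpace ℂ α} {v : κ → EuclideanSpace ℂ β}
    (h : IsSchmidtDecomposition ψ p u v) (n : ℕ) :
    IsSchmidtDecomposition (tensorPower ψ n) (productDist p n) (productVector u n)
      (productVector v n) where
  nonneg := productDist_nonneg h.nonneg n
  orthonormal_left := orthonormal_productVector h.orthonormal_left n
  orthonormal_right := orthonormal_productVector h.orthonormal_right n
  eq_sum a b := by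
    classical
    simp only [LocalConversion.tensorPower, h.eq_sum]
    rw [Finset.prod_univ_sum, Fintype.piFinset_univ]
    refine Finset.sum_congr rfl fun x _ => ?_
    rw [productDist, Real.sqrt_prod _ fun t _ => h.nonneg _]
    simp only [productVector, Finset.prod_mul_distrib, Complex.ofReal_prod]

theorem tensorPower_maxEntangled (d m : ℕ) (x y : Fin m → Fin d) :
    tensorPower (maxEntangled d) m (x, y) =
      if x = y then ((((√((d : ℝ) ^ m))⁻¹ : ℝ)) : ℂ) else 0 := by
  have h : √((d : ℝ) ^ m) = √(d : ℝ) ^ m := by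
    rw [Real.sqrt_eq_iff_mul_self_eq (by positivity) (by positivity), ← mul_pow,
      Real.mul_self_sqrt (by positivity)]
  simp only [tensorPower, maxEntangled]
  rw [Finset.prod_ite_zero]
  simp [funext_iff, h]

end TensorPower

end LocalConversion

theorem mainTheorem9 {α β κ : Type*} [Fintype α] [Fintype β] [Fintype κ]
    [DecidableEq α] [DecidableEq β]
    (d m n : ℕ) (hd : 0 < d)
    (ψ : LocalConversion.Bipartite α β) (hψ : ‖ψ‖ = 1)
    (p : κ → ℝ) (u : κ → EuclideanSpace ℂ α) (v : κ → EuclideanSpace ℂ β)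
    (hp : LocalConversion.IsSchmidtDecomposition ψ p u v)
    (K : ℕ) (hK : LocalConversion.numBlocks p d m n ≤ K) :
    -- the optimum over pairs of local channels is attained
    IsGreatest
      (LocalConversion.loFidelities
        (LocalConversion.density
          (LocalConversion.tensorPower (LocalConversion.maxEntangled d) m))
        (LocalConversion.density (LocalConversion.tensorPower ψ n)))
      (LocalConversion.optimalFidelityLO
        (LocalConversion.density
          (LocalConversion.tensorPower (LocalConversion.maxEntangled d) m))
        (LocalConversion.density (LocalConversion.tensorPower ψ n))) ∧
    -- the minimum of the program is attained
    IsLeast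
      (LocalConversion.distillationObjective p d m n K '' LocalConversion.decreasingDist K)
      (sInf (LocalConversion.distillationObjective p d m n K ''
        LocalConversion.decreasingDist K)) ∧
    -- the two optima are related as claimed
    LocalConversion.optimalFidelityLO
        (LocalConversion.density
          (LocalConversion.tensorPower (LocalConversion.maxEntangled d) m))
        (LocalConversion.density (LocalConversion.tensorPower ψ n)) =
      ((d : ℝ) ^ m)⁻¹ *
        (sInf (LocalConversion.distillationObjective p d m n K ''
          LocalConversion.decreasingDist K)) ^ 2 ∧
    -- the program is convex: convex feasible set and convex objective
    ConvexOn ℝ (LocalConversion.decreasingDist K)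
      (LocalConversion.distillationObjective p d m n K) := by
  have hq := LocalConversion.productDist_nonneg hp.nonneg n
  have hM : LocalConversion.distRank (LocalConversion.productDist p n) ≤ K * d ^ m :=
    LocalConversion.distRank_pow_le hd hK
  have hsum : ∑ x, LocalConversion.productDist p n x = 1 :=
    LocalConversion.sum_productDist (by rw [hp.sum_eq, hψ, one_pow]) n
  have hpos := LocalConversion.sum_blockSum_sq_pos hq hsum hM
  have hcard : Fintype.card (Fin m → Fin d) = d ^ m := by simp
  -- Makes the target alphabet nonempty, as the Kraus completion requires.
  have : NeZero d := ⟨hd.ne'⟩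
  have hgreat := LocalConversion.isGreatest_loFidelities (hp.tensorPower n)
    (LocalConversion.tensorPower_maxEntangled d m) (M := K) (by rwa [hcard])
  rw [hcard, inv_pow, Real.sq_sqrt (by positivity)] at hgreat
  have hopt := hgreat.csSup_eq
  have hleast := LocalConversion.isLeast_neg_sum_mul_sqrt
    (LocalConversion.blockSum_nonneg (LocalConversion.productDist p n) (d ^ m))
    (LocalConversion.blockSum_antitone hq (d ^ m)) hpos
  rw [← LocalConversion.distillationObjective_eq hp.nonneg hd] at hleast
  refine ⟨?_, ?_, ?_, ?_⟩
  · rw [LocalConversion.optimalFidelityLO, hopt]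
    exact hgreat
  · rw [hleast.csInf_eq]
    exact hleast
  · rw [LocalConversion.optimalFidelityLO, hopt, hleast.csInf_eq, neg_sq, Real.sq_sqrt hpos.le]
  · rw [LocalConversion.distillationObjective_eq hp.nonneg hd]
    exact LocalConversion.convexOn_neg_sum_mul_sqrt (LocalConversion.blockSum_nonneg _ _)
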